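/- Let $n\ge 1$, let $\Omega\subset\mathbb R^n$ be a bounded open set with smooth ($C^\infty$) boundary (not necessarily connected), and let $s\in(0,1)$. Let $H^s(\Omega)$ be the Hilbert space of all $u\in L^2(\Omega)$ with $$[u]_s^2:=\int_\Omega\int_\Omega\frac{|u(x)-u(y)|^2}{|x-y|^{n+2s}}\,dx\,dy<\infty,\qquad \|u\|_{H^s(\Omega)}^2:=\int_\Omega|u|^2\,dx+[u]_s^2 .$$ Let $W\in C^2(\mathbb R)$ be a double well potential: $W$ is even, $W\ge 0$, $W(\pm1)=0$, $W>0$ on $(-1,1)$, $W'(\pm1)=0$ and $W''(\pm1)>0$. Assume moreover the following growth condition (which holds if $W$ is quadratic at infinity, i.e. $W(t)\ge\alpha t^2-\beta$ and $|W'(t)|\le C(1+|t|)$ with $\alpha>0$): there are $\alpha>0$ and $\beta,C\in\mathbb R$ such that, for all $t\in\mathbb R$, $$W(t)\ge\alpha|t|-\beta,\qquad |W'(t)|\le C(1+|t|).$$ Let $\varepsilon>0$, with $\varepsilon\ne1$ if $s=1/2$, and define $F_\varepsilon:H^s(\Omega)\to\mathbb R$ by $$F_\varepsilon(u)=\begin{cases}[u]_s^2+\dfrac1{\varepsilon^{2s}}\displaystyle\int_\Omega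 W(u)\,dx,& s\in(0,1/2),\\[2mm] \dfrac1{|\log\varepsilon|}[u]_{1/2}^2+\dfrac1{|\varepsilon\log\varepsilon|}\displaystyle\int_\Omega W(u)\,dx,& s=1/2,\\[2mm] \dfrac{\varepsilon^{2s-1}}2[u]_s^2+\dfrac1\varepsilon\displaystyle\int_\Omega W(u)\,dx,& s\in(1/2,1).\end{cases}$$ Then $W(u)$ is integrable on $\Omega$ for every $u\in H^s(\Omega)$, $F_\varepsilon$ is of class $C^1$ on $H^s(\Omega)$, and $F_\varepsilon$ satisfies the Palais–Smale condition: every sequence $(u_i)$ in $H^s(\Omega)$ such that $(F_\varepsilon(u_i))$ is bounded and $F_\varepsilon'(u_i)\to0$ in the dual of $H^s(\Omega)$ is relatively compact in $H^s(\Omega)$. -/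

import Mathlib

open MeasureTheory Filter Topology Set
open scoped ContDiff

noncomputable section

namespace FracAllenCahn

/-- Bounded open subset of `ℝⁿ` with smooth boundary: near each boundary point the set is the
sublevel set `{ρ < 0}` of a smooth function whose differential does not vanish at that point.
Connectedness is not required. -/
structure IsSmoothBoundedDomain {n : ℕ} (Ω : Set (EuclideanSpace ℝ (Fin n))) : Prop where
  isOpen : IsOpen Ω
  isBounded : Bornology.IsBounded Ω
  smooth_boundary : ∀ x ∈ frontier Ω, ∃ U : Set (EuclideanSpace ℝ (Fin n)),
    ∃ ρ : EuclideanSpace ℝ (Fin n) → ℝ,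
      IsOpen U ∧ x ∈ U ∧ ContDiffOn ℝ ∞ ρ U ∧ fderiv ℝ ρ x ≠ 0 ∧ Ω ∩ U = {y ∈ U | ρ y < 0}

/-- Double well potential: an even, nonnegative `C²` function with nondegenerate zeros at `±1`,
positive in between. -/
structure IsDoubleWell (W : ℝ → ℝ) : Prop where
  contDiff : ContDiff ℝ 2 W
  even : ∀ t, W (-t) = W t
  nonneg : ∀ t, 0 ≤ W t
  zero_one : W 1 = 0
  zero_neg_one : W (-1) = 0
  pos : ∀ t ∈ Ioo (-1 : ℝ) 1, 0 < W t
  deriv_one : deriv W 1 = 0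
  deriv_neg_one : deriv W (-1) = 0
  deriv2_one : 0 < deriv (deriv W) 1
  deriv2_neg_one : 0 < deriv (deriv W) (-1)

/-- Growth at infinity: `W` is bounded below by a coercive function of linear growth, and `W'`
grows at most linearly, so that `W` grows at most quadratically. Every double well potential that
is quadratic at infinity, in the sense that `α t² - β ≤ W t` and `|W' t| ≤ C (1 + |t|)`,
satisfies this. -/
structure HasGrowth (W : ℝ → ℝ) : Prop where
  lower : ∃ α β : ℝ, 0 < α ∧ ∀ t, α * |t| - β ≤ W t
  deriv_upper : ∃ C : ℝ, ∀ t, |deriv W t| ≤ C * (1 + |t|)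

section Space

variable {n : ℕ}

/-- `(u(x) - u(y)) / |x - y| ^ (s + n/2)` -/
def diffQuot (s : ℝ) (u : EuclideanSpace ℝ (Fin n) → ℝ)
    (p : EuclideanSpace ℝ (Fin n) × EuclideanSpace ℝ (Fin n)) : ℝ :=
  (u p.1 - u p.2) / ‖p.1 - p.2‖ ^ (s + (n : ℝ) / 2)

/-- Lebesgue measure on `Ω × Ω`. -/
abbrev sqMeasure (Ω : Set (EuclideanSpace ℝ (Fin n))) :
    Measure (EuclideanSpace ℝ (Fin n) × EuclideanSpace ℝ (Fin n)) :=
  (volume.restrict Ω).prod (volume.restrict Ω)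

theorem diffQuot_congr (s : ℝ) {Ω : Set (EuclideanSpace ℝ (Fin n))}
    {u v : EuclideanSpace ℝ (Fin n) → ℝ} (h : u =ᵐ[volume.restrict Ω] v) :
    diffQuot s u =ᵐ[sqMeasure Ω] diffQuot s v := by
  have h1 := (Measure.quasiMeasurePreserving_fst (μ := volume.restrict Ω)
    (ν := volume.restrict Ω)).ae_eq_comp h
  have h2 := (Measure.quasiMeasurePreserving_snd (μ := volume.restrict Ω)
    (ν := volume.restrict Ω)).ae_eq_comp h
  filter_upwards [h1, h2] with p hp hq
  simp only [Function.comp_apply] at hp hq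
  simp only [diffQuot, hp, hq]

theorem diffQuot_add (s : ℝ) (u v : EuclideanSpace ℝ (Fin n) → ℝ) :
    diffQuot s (u + v) = diffQuot s u + diffQuot s v := by
  funext p
  simp only [diffQuot, Pi.add_apply]
  ring

theorem diffQuot_smul (s c : ℝ) (u : EuclideanSpace ℝ (Fin n) → ℝ) :
    diffQuot s (c • u) = c • diffQuot s u := by
  funext p
  simp only [diffQuot, Pi.smul_apply, smul_eq_mul]
  ring

/-- The elements `u` of `L²(Ω)` with `|u(x) - u(y)| / |x - y| ^ (s + n/2)` in `L²(Ω × Ω)`. -/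
def fracSobolevSubmodule (s : ℝ) (Ω : Set (EuclideanSpace ℝ (Fin n))) :
    Submodule ℝ (Lp ℝ 2 (volume.restrict Ω)) where
  carrier := {u | MemLp (diffQuot s u) 2 (sqMeasure Ω)}
  add_mem' {u v} hu hv := by
    have h := diffQuot_congr s (Lp.coeFn_add u v)
    rw [diffQuot_add] at h
    exact (memLp_congr_ae h).2 (MemLp.add hu hv)
  zero_mem' := by
    have h := diffQuot_congr s (Lp.coeFn_zero ℝ 2 (volume.restrict Ω))
    refine (memLp_congr_ae h).2 ?_
    have h0 : diffQuot s (0 : EuclideanSpace ℝ (Fin n) → ℝ) = 0 := by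
      funext p
      simp [diffQuot]
    rw [h0]
    exact MemLp.zero
  smul_mem' c u hu := by
    have h := diffQuot_congr s (Lp.coeFn_smul c u)
    rw [diffQuot_smul] at h
    exact (memLp_congr_ae h).2 (MemLp.const_smul hu c)

/-- The fractional Sobolev space `H^s(Ω) = W^{s,2}(Ω)`. It is a type of its own, since its norm
is not the one of `L²(Ω)`. -/
def FracSobolev (s : ℝ) (Ω : Set (EuclideanSpace ℝ (Fin n))) : Type :=
  fracSobolevSubmodule s Ω

variable {s : ℝ} {Ω : Set (EuclideanSpace ℝ (Fin n))}

instance : AddCommGroup (FracSobolev s Ω) :=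
  inferInstanceAs (AddCommGroup (fracSobolevSubmodule s Ω))

instance : Module ℝ (FracSobolev s Ω) :=
  inferInstanceAs (Module ℝ (fracSobolevSubmodule s Ω))

/-- The underlying element of `L²(Ω)`. -/
def FracSobolev.toL2 : FracSobolev s Ω →ₗ[ℝ] Lp ℝ 2 (volume.restrict Ω) :=
  (fracSobolevSubmodule s Ω).subtype

instance : CoeFun (FracSobolev s Ω) (fun _ => EuclideanSpace ℝ (Fin n) → ℝ) :=
  ⟨fun u => u.toL2⟩

/-- `∫_Ω u v + ∫_Ω ∫_Ω (u(x) - u(y)) (v(x) - v(y)) / |x - y| ^ (n + 2s)` -/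
def fracInner (u v : FracSobolev s Ω) : ℝ :=
  (∫ x in Ω, u x * v x) +
    ∫ p, (u p.1 - u p.2) * (v p.1 - v p.2) / ‖p.1 - p.2‖ ^ ((n : ℝ) + 2 * s) ∂(sqMeasure Ω)

theorem fracInner_eq (u v : FracSobolev s Ω) : fracInner u v =
    (∫ x in Ω, u x * v x) + ∫ p, diffQuot s u p * diffQuot s v p ∂(sqMeasure Ω) := by
  unfold fracInner
  congr 2
  funext p
  have h : ‖p.1 - p.2‖ ^ ((n : ℝ) + 2 * s)
      = ‖p.1 - p.2‖ ^ (s + (n : ℝ) / 2) * ‖p.1 - p.2‖ ^ (s + (n : ℝ) / 2) := by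
    rw [← pow_two, ← Real.rpow_natCast, ← Real.rpow_mul (norm_nonneg _)]
    congr 1
    push_cast
    ring
  rw [h, diffQuot, diffQuot, div_mul_div_comm]

theorem FracSobolev.memLp (u : FracSobolev s Ω) : MemLp u 2 (volume.restrict Ω) :=
  Lp.memLp u.toL2

theorem FracSobolev.memLp_diffQuot (u : FracSobolev s Ω) :
    MemLp (diffQuot s u) 2 (sqMeasure Ω) :=
  u.2

/-- The inner product of `H^s(Ω)`, with the laws of an inner product. -/
abbrev fracCore : InnerProductSpace.Core ℝ (FracSobolev s Ω) where
  inner u v := fracInner u v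
  conj_inner_symm u v := by
    simp only [fracInner_eq, conj_trivial, mul_comm]
  re_inner_nonneg u := by
    simp only [fracInner_eq, RCLike.re_to_real]
    exact add_nonneg (integral_nonneg fun x => mul_self_nonneg _)
      (integral_nonneg fun x => mul_self_nonneg _)
  add_left u v w := by
    have h : ⇑(u + v).toL2 =ᵐ[volume.restrict Ω] u + v := by
      rw [map_add]
      exact Lp.coeFn_add _ _
    have h' := diffQuot_congr s h
    rw [diffQuot_add] at h'
    have e1 : ∫ x in Ω, (u + v) x * w x = (∫ x in Ω, u x * w x) + ∫ x in Ω, v x * w x := by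
      refine Eq.trans (integral_congr_ae ?_)
        (integral_add (u.memLp.integrable_mul w.memLp) (v.memLp.integrable_mul w.memLp))
      filter_upwards [h] with x hx
      rw [hx, Pi.add_apply, add_mul]
    have e2 : ∫ p, diffQuot s (u + v) p * diffQuot s w p ∂(sqMeasure Ω) =
        (∫ p, diffQuot s u p * diffQuot s w p ∂(sqMeasure Ω)) +
          ∫ p, diffQuot s v p * diffQuot s w p ∂(sqMeasure Ω) := by
      refine Eq.trans (integral_congr_ae ?_)
        (integral_add (u.memLp_diffQuot.integrable_mul w.memLp_diffQuot)
          (v.memLp_diffQuot.integrable_mul w.memLp_diffQuot))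
      filter_upwards [h'] with x hx
      rw [hx, Pi.add_apply, add_mul]
    simp only [fracInner_eq]
    rw [e1, e2]
    ring
  smul_left u w c := by
    have h : ⇑(c • u).toL2 =ᵐ[volume.restrict Ω] c • u := by
      rw [map_smul]
      exact Lp.coeFn_smul _ _
    have h' := diffQuot_congr s h
    rw [diffQuot_smul] at h'
    have e1 : ∫ x in Ω, (c • u) x * w x = c * ∫ x in Ω, u x * w x := by
      rw [← integral_const_mul]
      refine integral_congr_ae ?_
      filter_upwards [h] with x hx
      rw [hx, Pi.smul_apply, smul_eq_mul, mul_assoc]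
    have e2 : ∫ p, diffQuot s (c • u) p * diffQuot s w p ∂(sqMeasure Ω) =
        c * ∫ p, diffQuot s u p * diffQuot s w p ∂(sqMeasure Ω) := by
      rw [← integral_const_mul]
      refine integral_congr_ae ?_
      filter_upwards [h'] with x hx
      rw [hx, Pi.smul_apply, smul_eq_mul, mul_assoc]
    simp only [fracInner_eq, conj_trivial]
    rw [e1, e2]
    ring
  definite u hu := by
    have hu' : fracInner u u = 0 := hu
    rw [fracInner_eq] at hu'
    have h1 : 0 ≤ ∫ x in Ω, u x * u x := integral_nonneg fun x => mul_self_nonneg _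
    have h2 : 0 ≤ ∫ p, diffQuot s u p * diffQuot s u p ∂(sqMeasure Ω) :=
      integral_nonneg fun x => mul_self_nonneg _
    have h3 : ∫ x in Ω, u x * u x = 0 := by linarith
    have h4 := (integral_eq_zero_iff_of_nonneg (fun x => mul_self_nonneg _)
      (u.memLp.integrable_mul u.memLp)).1 h3
    refine Subtype.ext ((Lp.eq_zero_iff_ae_eq_zero).2 ?_)
    filter_upwards [h4] with x hx
    exact mul_self_eq_zero.1 hx

instance : NormedAddCommGroup (FracSobolev s Ω) :=
  InnerProductSpace.Core.toNormedAddCommGroup (𝕜 := ℝ) (cd := fracCore)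

instance : InnerProductSpace ℝ (FracSobolev s Ω) :=
  InnerProductSpace.ofCore fracCore.toCore

/-- `∫_Ω ∫_Ω |u(x) - u(y)|² / |x - y| ^ (n + 2s) dx dy` -/
def gagliardo (u : FracSobolev s Ω) : ℝ :=
  ∫ p, |u p.1 - u p.2| ^ 2 / ‖p.1 - p.2‖ ^ ((n : ℝ) + 2 * s) ∂(sqMeasure Ω)

/-- The fractional Allen–Cahn functional `F_ε` on `H^s(Ω)`, for `0 < s < 1`. -/
def energy (ε : ℝ) (W : ℝ → ℝ) (u : FracSobolev s Ω) : ℝ :=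
  if s < 1 / 2 then
    gagliardo u + 1 / ε ^ (2 * s) * ∫ x in Ω, W (u x)
  else if s = 1 / 2 then
    1 / |Real.log ε| * gagliardo u + 1 / |ε * Real.log ε| * ∫ x in Ω, W (u x)
  else
    ε ^ (2 * s - 1) / 2 * gagliardo u + 1 / ε * ∫ x in Ω, W (u x)

end Space

/-- The Palais–Smale condition for a differentiable functional `f` on a normed space. -/
def PalaisSmale {H : Type*} [NormedAddCommGroup H] [NormedSpace ℝ H] (f : H → ℝ) : Prop :=
  ∀ u : ℕ → H, (∃ M : ℝ, ∀ i, |f (u i)| ≤ M) →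
    Tendsto (fun i => fderiv ℝ f (u i)) atTop (𝓝 0) →
    IsCompact (closure (range u))

end FracAllenCahn

end

/-! Write Du for the difference quotient of u. The map u ↦ (u, Du) embeds H^s(Ω) isometrically into
L²(Ω) × L²(Ω × Ω), and the energy is a‖Du‖² + b∫W(u) with a, b > 0. The first term is a continuous
quadratic form. The second is C¹ already on L²(Ω): as W' is continuous of linear growth, f ↦ W'(f)
is continuous from L² to L², and it is the gradient (`continuous_superposition`,
`hasFDerivAt_integral_comp`).

For the Palais–Smale condition, the energy bounds Du in L² because W ≥ 0, and u in L¹ because W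
dominates α|t| - β; Poincaré's inequality then bounds u in H^s. The compact embedding into L²
(`totallyBounded_image_toL2`) makes the sequence totally bounded there. Testing F'(u) - F'(v) on u -
v yields 2a‖D(u - v)‖² plus a term of order ‖u - v‖ in L², so closeness in L² and of the derivatives
forces closeness in H^s (`exists_dist_lt_of_dist_energyDeriv_lt`). The derivatives converge, hence
the sequence is totally bounded in H^s, which is complete.

The compact embedding rests on a local estimate: replacing u by its mean over Ω ∩ B(x, r) costs, by
Jensen, at most (2r)^(n+2s) / |Ω ∩ B(x, r)| times the Gagliardo density. The smooth boundary makes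
this factor small for suitable r, and a finite cover leaves only finitely many averages to control.
-/

noncomputable section

namespace FracAllenCahn

/-! ### Superposition operators and integral functionals on L². -/

section Superposition

variable {α : Type*} [MeasurableSpace α] {μ : Measure α}

/-- Dominated convergence in `L²` with a dominating sequence that converges in `L²`. -/
theorem tendsto_eLpNorm_sub_of_dominated [IsFiniteMeasure μ] {f V : ℕ → α → ℝ} {g w : α → ℝ}
    (hf : ∀ k, AEStronglyMeasurable (f k) μ) (hg : MemLp g 2 μ) (hV : ∀ k, MemLp (V k) 2 μ)
    (hw : MemLp w 2 μ) (hVw : Tendsto (fun k => eLpNorm (V k - w) 2 μ) atTop (𝓝 0))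
    (bound : ∀ k, ∀ᵐ x ∂μ, |f k x| ≤ |V k x|)
    (lim : ∀ᵐ x ∂μ, Tendsto (fun k => f k x) atTop (𝓝 (g x))) :
    Tendsto (fun k => eLpNorm (f k - g) 2 μ) atTop (𝓝 0) := by
  refine tendsto_Lp_finite_of_tendsto_ae (by norm_num) (by norm_num) hf hg ?_ lim
  intro ε hε
  -- Vitali's theorem: a sequence converging in L² is uniformly integrable, and domination passes
  -- this from `V` to `f`.
  obtain ⟨δ, hδ, h⟩ := unifIntegrable_of_tendsto_Lp (by norm_num) (by norm_num) hV hw hVw hε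
  refine ⟨δ, hδ, fun k t ht hμt => (eLpNorm_mono_ae ?_).trans (h k t ht hμt)⟩
  filter_upwards [bound k] with x hx
  by_cases hxt : x ∈ t <;> simp [hxt, hx]

theorem Lp.exists_subseq_tendsto_ae {f : ℕ → Lp ℝ 2 μ} {g : Lp ℝ 2 μ}
    (h : Tendsto f atTop (𝓝 g)) : ∃ ms : ℕ → ℕ, StrictMono ms ∧
      ∀ᵐ x ∂μ, Tendsto (fun k => f (ms k) x) atTop (𝓝 (g x)) :=
  (tendstoInMeasure_of_tendsto_Lp h).exists_seq_tendsto_ae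

variable {φ : ℝ → ℝ} {C : ℝ}

theorem memLp_superposition [IsFiniteMeasure μ] (hc : Continuous φ)
    (hC : ∀ t, |φ t| ≤ C * (1 + |t|)) (f : Lp ℝ 2 μ) : MemLp (fun x => φ (f x)) 2 μ := by
  have h : MemLp (fun x => C * (1 + |f x|)) 2 μ :=
    ((memLp_const (1 : ℝ)).add (Lp.memLp f).abs).const_mul C
  refine h.mono (hc.comp_aestronglyMeasurable (Lp.aestronglyMeasurable f)) ?_
  exact Eventually.of_forall fun x => (hC _).trans (le_abs_self _)

/-- The superposition operator `f ↦ φ ∘ f` on `L²`, for `φ` continuous of linear growth. -/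
def superposition [IsFiniteMeasure μ] (hc : Continuous φ) (hC : ∀ t, |φ t| ≤ C * (1 + |t|))
    (f : Lp ℝ 2 μ) : Lp ℝ 2 μ :=
  (memLp_superposition hc hC f).toLp

theorem coeFn_superposition [IsFiniteMeasure μ] (hc : Continuous φ)
    (hC : ∀ t, |φ t| ≤ C * (1 + |t|)) (f : Lp ℝ 2 μ) :
    superposition hc hC f =ᵐ[μ] fun x => φ (f x) :=
  MemLp.coeFn_toLp _

theorem norm_superposition_le [IsFiniteMeasure μ] (hc : Continuous φ)
    (hC : ∀ t, |φ t| ≤ C * (1 + |t|)) (f : Lp ℝ 2 μ) :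
    ‖superposition hc hC f‖ ≤ C * (‖Lp.const 2 μ (1 : ℝ)‖ + ‖f‖) := by
  have hC0 : 0 ≤ C := by simpa using (abs_nonneg _).trans (hC 0)
  have h : ‖superposition hc hC f‖ ≤ C * ‖Lp.const 2 μ (1 : ℝ) + |f|‖ := by
    refine Lp.norm_le_mul_norm_of_ae_le_mul ?_
    filter_upwards [coeFn_superposition hc hC f, Lp.coeFn_add (Lp.const 2 μ (1 : ℝ)) |f|,
      Lp.coeFn_const 2 μ (1 : ℝ), Lp.coeFn_abs f] with x h1 h2 h3 h4
    rw [h1, h2, Pi.add_apply, h3, h4, Real.norm_eq_abs, Real.norm_eq_abs]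
    exact (hC _).trans (mul_le_mul_of_nonneg_left (le_abs_self _) hC0)
  refine h.trans (mul_le_mul_of_nonneg_left ((norm_add_le _ _).trans ?_) hC0)
  rw [norm_abs_eq_norm]

theorem tendsto_eLpNorm_abs_add {f : ℕ → Lp ℝ 2 μ} {g : Lp ℝ 2 μ} (h : Tendsto f atTop (𝓝 g))
    (c : ℝ) (v : α → ℝ) : Tendsto (fun k => eLpNorm
      ((fun x => c * (v x + |f k x|)) - (fun x => c * (v x + |g x|))) 2 μ) atTop (𝓝 0) := by
  have h0 : Tendsto (fun k => ENNReal.ofReal |c| * eLpNorm (f k - g : α → ℝ) 2 μ) atTop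
      (𝓝 (ENNReal.ofReal |c| * 0)) :=
    ENNReal.Tendsto.const_mul ((Lp.tendsto_Lp_iff_tendsto_eLpNorm' f g).1 h)
      (Or.inr ENNReal.ofReal_ne_top)
  rw [mul_zero] at h0
  refine tendsto_of_tendsto_of_tendsto_of_le_of_le tendsto_const_nhds h0 (fun _ => zero_le) ?_
  intro k
  refine eLpNorm_le_mul_eLpNorm_of_ae_le_mul (Eventually.of_forall fun x => ?_) 2
  simp only [Pi.sub_apply, Real.norm_eq_abs]
  rw [show c * (v x + |f k x|) - c * (v x + |g x|) = c * (|f k x| - |g x|) by ring, abs_mul]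
  exact mul_le_mul_of_nonneg_left (abs_abs_sub_abs_le _ _) (abs_nonneg c)

theorem continuous_superposition [IsFiniteMeasure μ] (hc : Continuous φ)
    (hC : ∀ t, |φ t| ≤ C * (1 + |t|)) :
    Continuous (superposition (μ := μ) hc hC) := by
  rw [continuous_iff_seqContinuous]
  intro f g hfg
  -- L² convergence gives a.e. convergence only along subsequences, so it is enough to extract from
  -- each subsequence a further one along which the images converge.
  refine tendsto_of_subseq_tendsto fun ns hns => ?_
  obtain ⟨ms, hms, hae⟩ := Lp.exists_subseq_tendsto_ae (hfg.comp hns)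
  have hsub : Tendsto (fun k => f (ns (ms k))) atTop (𝓝 g) :=
    (hfg.comp hns).comp hms.tendsto_atTop
  refine ⟨ms, ?_⟩
  refine (Lp.tendsto_Lp_iff_tendsto_eLpNorm'' _ (fun k => memLp_superposition hc hC _) _
    (memLp_superposition hc hC g)).2 ?_
  refine tendsto_eLpNorm_sub_of_dominated (V := fun k x => C * (1 + |f (ns (ms k)) x|))
    (w := fun x => C * (1 + |g x|)) (fun k => (memLp_superposition hc hC _).1)
    (memLp_superposition hc hC g)
    (fun k => ((memLp_const (1 : ℝ)).add (Lp.memLp (f (ns (ms k)))).abs).const_mul C)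
    (((memLp_const (1 : ℝ)).add (Lp.memLp g).abs).const_mul C)
    (tendsto_eLpNorm_abs_add hsub C 1)
    (fun k => Eventually.of_forall fun x => (hC _).trans (le_abs_self _)) ?_
  filter_upwards [hae] with x hx
  exact (hc.tendsto _).comp hx

variable {W : ℝ → ℝ}

theorem abs_sub_le_of_deriv_growth (hW : Differentiable ℝ W)
    (hC : ∀ t, |deriv W t| ≤ C * (1 + |t|)) (a b : ℝ) :
    |W b - W a| ≤ C * (1 + |a| + |b|) * |b - a| := by
  have hC0 : 0 ≤ C := by simpa using (abs_nonneg _).trans (hC 0)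
  refine (convex_uIcc a b).norm_image_sub_le_of_norm_deriv_le (f := W)
    (fun x _ => hW x) (fun x hx => (hC x).trans ?_) left_mem_uIcc right_mem_uIcc
  refine mul_le_mul_of_nonneg_left ?_ hC0
  have : |x| ≤ max |a| |b| := by
    rcases mem_uIcc.1 hx with h | h
    · exact abs_le_max_abs_abs h.1 h.2
    · rw [max_comm]; exact abs_le_max_abs_abs h.1 h.2
  linarith [max_le_add_of_nonneg (abs_nonneg a) (abs_nonneg b)]

theorem integrable_comp_of_deriv_growth [IsFiniteMeasure μ] (hW : Differentiable ℝ W)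
    (hC : ∀ t, |deriv W t| ≤ C * (1 + |t|)) (f : Lp ℝ 2 μ) :
    Integrable (fun x => W (f x)) μ := by
  have h1 : MemLp (fun x => C * (1 + |f x|)) 2 μ :=
    ((memLp_const (1 : ℝ)).add (Lp.memLp f).abs).const_mul C
  have h2 : Integrable (fun x => |W 0| + C * (1 + |f x|) * |f x|) μ :=
    (integrable_const _).add (h1.integrable_mul (Lp.memLp f).abs)
  refine h2.mono' (hW.continuous.comp_aestronglyMeasurable (Lp.aestronglyMeasurable f)) ?_
  refine Eventually.of_forall fun x => ?_
  have h3 := abs_sub_le_of_deriv_growth hW hC 0 (f x)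
  simp only [abs_zero, add_zero, sub_zero] at h3
  rw [Real.norm_eq_abs]
  calc |W (f x)| = |W 0 + (W (f x) - W 0)| := by ring_nf
    _ ≤ |W 0| + |W (f x) - W 0| := abs_add_le _ _
    _ ≤ _ := by linarith

/-- Dividing the pointwise Taylor remainder by v - f gives a function r that is dominated by 2C(1 +
|f| + |v|) and tends to 0 a.e. along a subsequence, hence in L². The remainder of the functional is
⟨r, v - f⟩, and Cauchy–Schwarz makes it o(‖v - f‖). -/
theorem hasFDerivAt_integral_comp [IsFiniteMeasure μ] (hW : Differentiable ℝ W)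
    (hW' : Continuous (deriv W)) (hC : ∀ t, |deriv W t| ≤ C * (1 + |t|)) (f : Lp ℝ 2 μ) :
    HasFDerivAt (fun g : Lp ℝ 2 μ => ∫ x, W (g x) ∂μ)
      (innerSL ℝ (superposition hW' hC f)) f := by
  have hC0 : 0 ≤ C := by simpa using (abs_nonneg _).trans (hC 0)
  rw [hasFDerivAt_iff_tendsto]
  refine tendsto_of_seq_tendsto fun u hu => tendsto_of_subseq_tendsto fun ns hns => ?_
  obtain ⟨ms, hms, hae⟩ := Lp.exists_subseq_tendsto_ae (hu.comp hns)
  have hsub : Tendsto (fun k => u (ns (ms k))) atTop (𝓝 f) :=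
    (hu.comp hns).comp hms.tendsto_atTop
  refine ⟨ms, ?_⟩
  set v : ℕ → Lp ℝ 2 μ := fun k => u (ns (ms k)) with hv
  -- Where v = f the quotient is 0 by the convention on division; the numerator vanishes there too,
  -- so r · (v - f) is the remainder everywhere.
  let r : ℕ → α → ℝ := fun k x =>
    (W (v k x) - W (f x) - deriv W (f x) * (v k x - f x)) / (v k x - f x)
  let V : ℕ → α → ℝ := fun k x => (2 * C) * (1 + |f x| + |v k x|)
  have hrmeas : ∀ k, AEStronglyMeasurable (r k) μ := by
    intro k
    have m1 := Lp.aestronglyMeasurable (v k)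
    have m2 := Lp.aestronglyMeasurable f
    have m3 := (((hW.continuous.comp_aestronglyMeasurable m1).sub
      (hW.continuous.comp_aestronglyMeasurable m2)).sub
      ((hW'.comp_aestronglyMeasurable m2).mul (m1.sub m2)))
    exact (m3.aemeasurable.div (m1.sub m2).aemeasurable).aestronglyMeasurable
  have hV : ∀ g : Lp ℝ 2 μ, MemLp (fun x => (2 * C) * (1 + |f x| + |g x|)) 2 μ := fun g =>
    (((memLp_const (1 : ℝ)).add (Lp.memLp f).abs).add (Lp.memLp g).abs).const_mul _
  have hbound : ∀ k x, |r k x| ≤ |V k x| := by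
    intro k x
    have h0 : 0 ≤ V k x := by positivity
    rw [abs_of_nonneg h0, abs_div]
    refine div_le_of_le_mul₀ (abs_nonneg _) h0 ?_
    have h1 := abs_sub_le_of_deriv_growth hW hC (f x) (v k x)
    have h2 : |deriv W (f x) * (v k x - f x)| ≤ C * (1 + |f x| + |v k x|) * |v k x - f x| := by
      rw [abs_mul]
      refine mul_le_mul_of_nonneg_right ((hC _).trans ?_) (abs_nonneg _)
      exact mul_le_mul_of_nonneg_left (by linarith [abs_nonneg (v k x)]) hC0
    calc _ ≤ |W (v k x) - W (f x)| + |deriv W (f x) * (v k x - f x)| := abs_sub _ _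
      _ ≤ _ := by simp only [V]; linarith
  have hr2 : ∀ k, MemLp (r k) 2 μ := fun k =>
    (hV (v k)).mono (hrmeas k) (Eventually.of_forall (hbound k))
  have hrlim : Tendsto (fun k => eLpNorm (r k - 0) 2 μ) atTop (𝓝 0) := by
    refine tendsto_eLpNorm_sub_of_dominated hrmeas MemLp.zero (fun k => hV (v k)) (hV f)
      (tendsto_eLpNorm_abs_add hsub (2 * C) fun x => 1 + |f x|)
      (fun k => Eventually.of_forall (hbound k)) ?_
    filter_upwards [hae] with x hx
    have hd := (hasDerivAt_iff_isLittleO.1 (hW (f x)).hasDerivAt).tendsto_div_nhds_zero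
    refine (hd.comp hx).congr fun k => ?_
    simp [r, hv, mul_comm]
  have hnorm : Tendsto (fun k => ‖(hr2 k).toLp‖) atTop (𝓝 0) := by
    simp only [Lp.norm_toLp, sub_zero] at hrlim ⊢
    exact (ENNReal.tendsto_toReal ENNReal.zero_ne_top).comp hrlim
  refine squeeze_zero (fun k => mul_nonneg (inv_nonneg.2 (norm_nonneg _)) (norm_nonneg _)) (fun k => ?_) hnorm
  have key : (∫ x, W (v k x) ∂μ) - (∫ x, W (f x) ∂μ)
      - inner ℝ (superposition hW' hC f) (v k - f) = inner ℝ (hr2 k).toLp (v k - f) := by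
    have i1 := integrable_comp_of_deriv_growth hW hC (v k)
    have i2 := integrable_comp_of_deriv_growth hW hC f
    rw [L2.inner_def, L2.inner_def, ← integral_sub i1 i2,
      ← integral_sub (f := fun x => W (v k x) - W (f x)) (i1.sub i2) (L2.integrable_inner _ _)]
    refine integral_congr_ae ?_
    filter_upwards [Lp.coeFn_sub (v k) f, coeFn_superposition hW' hC f,
      (hr2 k).coeFn_toLp] with x h1 h2 h3
    simp only [h1, h2, h3, Pi.sub_apply, r, RCLike.inner_apply, conj_trivial]
    by_cases h : v k x - f x = 0
    · have : v k x = f x := sub_eq_zero.1 h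
      simp [this]
    · field_simp
  change ‖v k - f‖⁻¹ * ‖(∫ x, W (v k x) ∂μ) - (∫ x, W (f x) ∂μ)
      - inner ℝ (superposition hW' hC f) (v k - f)‖ ≤ _
  rw [key]
  have h4 := norm_inner_le_norm (𝕜 := ℝ) (hr2 k).toLp (v k - f)
  rcases (norm_nonneg (v k - f)).eq_or_lt with h | h
  · simp [← h]
  · rw [inv_mul_le_iff₀ h]
    linarith

end Superposition

/-! ### Interior balls and volume density at points of the closure. -/

section Density

variable {n : ℕ}

/-- Along a direction v with L v = -1, ρ decreases by t to first order. Moving off x + tv by less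
than κt changes L by less than t/2, and the differentiability error is at most t/2, so ρ stays
negative. -/
theorem exists_ball_subset_of_hasFDerivAt {E : Type*} [NormedAddCommGroup E]
    [NormedSpace ℝ E] {ρ : E → ℝ} {L : E →L[ℝ] ℝ} {x : E} (hρ : HasFDerivAt ρ L x) (hL : L ≠ 0)
    (hx : ρ x ≤ 0) {U : Set E} (hU : U ∈ 𝓝 x) :
    ∃ v : E, ∃ κ : ℝ, 0 < κ ∧ ∃ τ : ℝ, 0 < τ ∧ ∀ t ∈ Ioo 0 τ,
      Metric.ball (x + t • v) (κ * t) ⊆ {y ∈ U | ρ y < 0} := by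
  obtain ⟨v, hv⟩ : ∃ v, L v = -1 := by
    obtain ⟨w, hw⟩ : ∃ w, L w ≠ 0 := by
      by_contra! h
      exact hL (ContinuousLinearMap.ext h)
    exact ⟨(-(L w)⁻¹) • w, by simp [hw]⟩
  have hLn : 0 ≤ ‖L‖ := norm_nonneg L
  set κ : ℝ := (2 * (‖L‖ + 1))⁻¹ with hκ
  have hκ0 : 0 < κ := by positivity
  have hκL : ‖L‖ * κ < 1 / 2 := by
    rw [hκ, ← div_eq_mul_inv, div_lt_div_iff₀ (by positivity) (by norm_num)]
    linarith
  set R : ℝ := ‖v‖ + κ with hR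
  have hR0 : 0 < R := by positivity
  have ho := (hasFDerivAt_iff_isLittleO.1 hρ).def (c := (2 * R)⁻¹) (by positivity)
  obtain ⟨δ, hδ, hball⟩ := Metric.mem_nhds_iff.1 (inter_mem hU ho)
  refine ⟨v, κ, hκ0, δ / R, by positivity, fun t ht y hy => ?_⟩
  obtain ⟨ht0, htτ⟩ := ht
  have htR : t * R < δ := (lt_div_iff₀ hR0).1 htτ
  set w : E := y - (x + t • v) with hw
  have hwn : ‖w‖ < κ * t := by rwa [mem_ball_iff_norm] at hy
  have hyx : y - x = t • v + w := by rw [hw]; abel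
  have hyn : ‖y - x‖ < t * R := by
    rw [hyx]
    calc _ ≤ ‖t • v‖ + ‖w‖ := norm_add_le _ _
      _ < t * ‖v‖ + κ * t := by rw [norm_smul, Real.norm_of_nonneg ht0.le]; linarith
      _ = t * R := by rw [hR]; ring
  have hyb : y ∈ Metric.ball x δ := by rw [mem_ball_iff_norm]; exact hyn.trans htR
  obtain ⟨hyU, hyo⟩ := hball hyb
  refine ⟨hyU, ?_⟩
  have h1 : ‖ρ y - ρ x - L (y - x)‖ ≤ (2 * R)⁻¹ * ‖y - x‖ := hyo
  have h2 : (2 * R)⁻¹ * ‖y - x‖ ≤ t / 2 := by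
    rw [inv_mul_le_iff₀ (by positivity)]
    linarith
  have h3 : L (y - x) = -t + L w := by rw [hyx, map_add, map_smul, hv]; simp
  have h4 : L w ≤ ‖L‖ * ‖w‖ := (le_abs_self _).trans (L.le_opNorm w)
  have h5 : ‖L‖ * ‖w‖ ≤ ‖L‖ * κ * t := by
    rw [mul_assoc]; exact mul_le_mul_of_nonneg_left hwn.le hLn
  have h6 : ‖L‖ * κ * t < 1 / 2 * t := mul_lt_mul_of_pos_right hκL ht0
  have h7 := (le_abs_self _).trans h1
  linarith

/-- At each point of its closure, a bounded domain with smooth boundary contains balls of radius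
comparable to their distance from that point, arbitrarily close to it. -/
theorem IsSmoothBoundedDomain.exists_ball_subset {Ω : Set (EuclideanSpace ℝ (Fin n))}
    (hΩ : IsSmoothBoundedDomain Ω) {x : EuclideanSpace ℝ (Fin n)} (hx : x ∈ closure Ω) :
    ∃ v : EuclideanSpace ℝ (Fin n), ∃ κ : ℝ, 0 < κ ∧ ∃ τ : ℝ, 0 < τ ∧ ∀ t ∈ Ioo 0 τ,
      Metric.ball (x + t • v) (κ * t) ⊆ Ω := by
  by_cases hxΩ : x ∈ Ω
  · obtain ⟨δ, hδ, hb⟩ := Metric.isOpen_iff.1 hΩ.isOpen x hxΩ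
    refine ⟨0, 1, one_pos, δ, hδ, fun t ht => ?_⟩
    rw [smul_zero, add_zero, one_mul]
    exact (Metric.ball_subset_ball ht.2.le).trans hb
  · have hfr : x ∈ frontier Ω := by
      rw [frontier, hΩ.isOpen.interior_eq]; exact ⟨hx, hxΩ⟩
    obtain ⟨U, ρ, hU, hxU, hρ, hd, heq⟩ := hΩ.smooth_boundary x hfr
    have hdiff : DifferentiableAt ℝ ρ x :=
      (hρ.contDiffAt (hU.mem_nhds hxU)).differentiableAt (by simp)
    have hx0 : ρ x ≤ 0 := by
      by_contra! h
      have h1 : ∀ᶠ y in 𝓝 x, 0 < ρ y ∧ y ∈ U :=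
        (hdiff.continuousAt.eventually (lt_mem_nhds h)).and (hU.mem_nhds hxU)
      obtain ⟨y, ⟨hy1, hy2⟩, hy3⟩ := (mem_closure_iff_frequently.1 hx).and_eventually h1 |>.exists
        |>.imp fun y hy => And.intro hy.2 hy.1
      have : y ∈ {y ∈ U | ρ y < 0} := heq ▸ ⟨hy3, hy2⟩
      exact lt_asymm hy1 this.2
    obtain ⟨v, κ, hκ, τ, hτ, h⟩ := exists_ball_subset_of_hasFDerivAt hdiff.hasFDerivAt hd hx0
      (hU.mem_nhds hxU)
    exact ⟨v, κ, hκ, τ, hτ, fun t ht => (h t ht).trans (heq ▸ inter_subset_left)⟩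

/-- Near each point of its closure, a bounded domain with smooth boundary has positive density, so
that `|Ω ∩ B(x, r)|` dominates `r ^ (n + 2s)` for some small `r`. -/
theorem IsSmoothBoundedDomain.exists_radius {Ω : Set (EuclideanSpace ℝ (Fin n))}
    (hΩ : IsSmoothBoundedDomain Ω) {x : EuclideanSpace ℝ (Fin n)} (hx : x ∈ closure Ω)
    {s η : ℝ} (hs : 0 < s) (hη : 0 < η) :
    ∃ r : ℝ, 0 < r ∧ 0 < volume.real (Ω ∩ Metric.ball x r) ∧
      (2 * r) ^ ((n : ℝ) + 2 * s) ≤ η * volume.real (Ω ∩ Metric.ball x r) := by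
  obtain ⟨v, κ, hκ, τ, hτ, h⟩ := hΩ.exists_ball_subset hx
  set R : ℝ := ‖v‖ + κ with hR
  have hR0 : 0 < R := by positivity
  set b : ℝ := volume.real (Metric.ball (0 : EuclideanSpace ℝ (Fin n)) 1) with hb
  have hb0 : 0 < b := ENNReal.toReal_pos (Metric.measure_ball_pos _ _ one_pos).ne'
    measure_ball_lt_top.ne
  -- The inner ball of radius κt has volume of order t^n, whereas the left side has order t^(n+2s);
  -- the surplus factor t^(2s) absorbs all constants.
  have hlim : Tendsto (fun t : ℝ => (2 * R) ^ ((n : ℝ) + 2 * s) * t ^ (2 * s)) (𝓝[>] 0) (𝓝 0) := by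
    have : Tendsto (fun t : ℝ => (2 * R) ^ ((n : ℝ) + 2 * s) * t ^ (2 * s)) (𝓝 0)
        (𝓝 ((2 * R) ^ ((n : ℝ) + 2 * s) * 0 ^ (2 * s))) :=
      tendsto_const_nhds.mul
        ((Real.continuousAt_rpow_const 0 (2 * s) (Or.inr (by positivity))).tendsto)
    rw [Real.zero_rpow (by positivity), mul_zero] at this
    exact this.mono_left nhdsWithin_le_nhds
  have hsmall : ∀ᶠ t in 𝓝[>] (0 : ℝ),
      (2 * R) ^ ((n : ℝ) + 2 * s) * t ^ (2 * s) < η * (κ ^ n * b) :=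
    hlim.eventually (gt_mem_nhds (by positivity))
  obtain ⟨t, ht, ht'⟩ := (hsmall.and (Ioo_mem_nhdsGT hτ)).exists
  have ht0 : 0 < t := ht'.1
  have hsub : Metric.ball (x + t • v) (κ * t) ⊆ Ω ∩ Metric.ball x (R * t) := by
    refine subset_inter (h t ht') (Metric.ball_subset_ball' ?_)
    rw [dist_self_add_left, norm_smul, Real.norm_of_nonneg ht0.le, hR]
    linarith
  have hvol : (κ * t) ^ n * b ≤ volume.real (Ω ∩ Metric.ball x (R * t)) := by
    have h1 : volume.real (Metric.ball (x + t • v) (κ * t)) = (κ * t) ^ n * b := by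
      have := Measure.addHaar_ball_of_pos (volume : Measure (EuclideanSpace ℝ (Fin n)))
        (x + t • v) (r := κ * t) (by positivity)
      replace this := congrArg ENNReal.toReal this
      rw [ENNReal.toReal_mul, ENNReal.toReal_ofReal (by positivity)] at this
      rwa [finrank_euclideanSpace_fin] at this
    rw [← h1]
    exact measureReal_mono hsub
      ((measure_mono inter_subset_right).trans_lt measure_ball_lt_top).ne
  refine ⟨R * t, by positivity, lt_of_lt_of_le (by positivity) hvol, ?_⟩
  calc (2 * (R * t)) ^ ((n : ℝ) + 2 * s)
      = (2 * R) ^ ((n : ℝ) + 2 * s) * t ^ (2 * s) * t ^ n := by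
        rw [← mul_assoc, Real.mul_rpow (by positivity) ht0.le, Real.rpow_add ht0,
          Real.rpow_natCast]
        ring
    _ ≤ η * (κ ^ n * b) * t ^ n := mul_le_mul_of_nonneg_right ht.le (by positivity)
    _ = η * ((κ * t) ^ n * b) := by rw [mul_pow]; ring
    _ ≤ _ := mul_le_mul_of_nonneg_left hvol hη.le

end Density

/-! ### H^s(Ω) as a complete subspace of L²(Ω) × L²(Ω × Ω). -/

section Space

variable {n : ℕ} {s : ℝ} {Ω : Set (EuclideanSpace ℝ (Fin n))}

/-- The difference quotient as a linear map `H^s(Ω) → L²(Ω × Ω)`. -/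
def diffQuotL2 : FracSobolev s Ω →ₗ[ℝ] Lp ℝ 2 (sqMeasure Ω) where
  toFun u := u.memLp_diffQuot.toLp
  map_add' u v := by
    rw [← MemLp.toLp_add, MemLp.toLp_eq_toLp_iff, ← diffQuot_add]
    refine diffQuot_congr s ?_
    rw [map_add]
    exact Lp.coeFn_add _ _
  map_smul' c u := by
    rw [RingHom.id_apply, ← MemLp.toLp_const_smul, MemLp.toLp_eq_toLp_iff, ← diffQuot_smul]
    refine diffQuot_congr s ?_
    rw [map_smul]
    exact Lp.coeFn_smul _ _

theorem coeFn_diffQuotL2 (u : FracSobolev s Ω) :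
    diffQuotL2 u =ᵐ[sqMeasure Ω] diffQuot s u :=
  u.memLp_diffQuot.coeFn_toLp

theorem inner_eq_add (u v : FracSobolev s Ω) :
    inner ℝ u v = inner ℝ u.toL2 v.toL2 + inner ℝ (diffQuotL2 u) (diffQuotL2 v) := by
  change fracInner u v = _
  rw [fracInner_eq, L2.inner_def, L2.inner_def]
  congr 1
  · exact integral_congr_ae (Eventually.of_forall fun x => by simp [mul_comm])
  · refine integral_congr_ae ?_
    filter_upwards [coeFn_diffQuotL2 u, coeFn_diffQuotL2 v] with p h1 h2
    simp [h1, h2, mul_comm]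

theorem norm_sq_eq_add (u : FracSobolev s Ω) :
    ‖u‖ ^ 2 = ‖u.toL2‖ ^ 2 + ‖diffQuotL2 u‖ ^ 2 := by
  simp only [← real_inner_self_eq_norm_sq, inner_eq_add]

theorem norm_toL2_le (u : FracSobolev s Ω) : ‖u.toL2‖ ≤ ‖u‖ :=
  le_of_sq_le_sq (by rw [norm_sq_eq_add u]; linarith [sq_nonneg ‖diffQuotL2 u‖]) (norm_nonneg u)

theorem norm_diffQuotL2_le (u : FracSobolev s Ω) : ‖diffQuotL2 u‖ ≤ ‖u‖ :=
  le_of_sq_le_sq (by rw [norm_sq_eq_add u]; linarith [sq_nonneg ‖u.toL2‖]) (norm_nonneg u)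

/-- The inclusion `H^s(Ω) → L²(Ω)`. -/
def toL2CLM : FracSobolev s Ω →L[ℝ] Lp ℝ 2 (volume.restrict Ω) :=
  FracSobolev.toL2.mkContinuous 1 fun u => by rw [one_mul]; exact norm_toL2_le u

/-- The difference quotient as a continuous linear map `H^s(Ω) → L²(Ω × Ω)`. -/
def diffQuotCLM : FracSobolev s Ω →L[ℝ] Lp ℝ 2 (sqMeasure Ω) :=
  diffQuotL2.mkContinuous 1 fun u => by rw [one_mul]; exact norm_diffQuotL2_le u

@[simp] theorem toL2CLM_apply (u : FracSobolev s Ω) : toL2CLM u = u.toL2 := rfl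

@[simp] theorem diffQuotCLM_apply (u : FracSobolev s Ω) : diffQuotCLM u = diffQuotL2 u := rfl

theorem norm_diffQuotL2_sq (u : FracSobolev s Ω) :
    ‖diffQuotL2 u‖ ^ 2 = ∫ p, diffQuot s u p ^ 2 ∂(sqMeasure Ω) := by
  rw [← real_inner_self_eq_norm_sq, L2.inner_def]
  refine integral_congr_ae ?_
  filter_upwards [coeFn_diffQuotL2 u] with p h
  simp [h, pow_two]

theorem norm_toL2_sq (u : FracSobolev s Ω) : ‖u.toL2‖ ^ 2 = ∫ x in Ω, u x ^ 2 := by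
  rw [← real_inner_self_eq_norm_sq, L2.inner_def]
  exact integral_congr_ae (Eventually.of_forall fun x => by simp [pow_two])

theorem diffQuot_sq (s : ℝ) (u : EuclideanSpace ℝ (Fin n) → ℝ)
    (p : EuclideanSpace ℝ (Fin n) × EuclideanSpace ℝ (Fin n)) :
    diffQuot s u p ^ 2 = |u p.1 - u p.2| ^ 2 / ‖p.1 - p.2‖ ^ ((n : ℝ) + 2 * s) := by
  rw [diffQuot, div_pow, sq_abs]
  congr 1
  rw [← Real.rpow_natCast, ← Real.rpow_mul (norm_nonneg _)]
  congr 1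
  push_cast
  ring

theorem gagliardo_eq (u : FracSobolev s Ω) : gagliardo u = ‖diffQuotL2 u‖ ^ 2 := by
  rw [norm_diffQuotL2_sq]
  simp only [diffQuot_sq]
  rfl

theorem diffQuot_tendsto_ae {f : ℕ → EuclideanSpace ℝ (Fin n) → ℝ}
    {g : EuclideanSpace ℝ (Fin n) → ℝ}
    (h : ∀ᵐ x ∂(volume.restrict Ω), Tendsto (fun k => f k x) atTop (𝓝 (g x))) :
    ∀ᵐ p ∂(sqMeasure Ω), Tendsto (fun k => diffQuot s (f k) p) atTop (𝓝 (diffQuot s g p)) := by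
  have h1 := (Measure.quasiMeasurePreserving_fst (μ := volume.restrict Ω)
    (ν := volume.restrict Ω)).ae h
  have h2 := (Measure.quasiMeasurePreserving_snd (μ := volume.restrict Ω)
    (ν := volume.restrict Ω)).ae h
  filter_upwards [h1, h2] with p hp hq
  exact (hp.sub hq).div_const _

/-- The difference quotient is a closed operator: a.e. convergence of u along a subsequence forces
that of its difference quotients, which identifies their L² limit. -/
instance : CompleteSpace (FracSobolev s Ω) := by
  refine Metric.complete_of_cauchySeq_tendsto fun u hu => ?_
  obtain ⟨v, hv⟩ := cauchySeq_tendsto_of_complete (toL2CLM.uniformContinuous.comp_cauchySeq hu)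
  obtain ⟨g, hg⟩ := cauchySeq_tendsto_of_complete (diffQuotCLM.uniformContinuous.comp_cauchySeq hu)
  obtain ⟨ms, hms, hae⟩ := Lp.exists_subseq_tendsto_ae hv
  obtain ⟨ks, hks, hae'⟩ := Lp.exists_subseq_tendsto_ae (hg.comp hms.tendsto_atTop)
  have hD := diffQuot_tendsto_ae (s := s) hae
  have hgv : diffQuot s v =ᵐ[sqMeasure Ω] g := by
    have hall : ∀ᵐ p ∂(sqMeasure Ω), ∀ k, diffQuotL2 (u k) p = diffQuot s (u k) p :=
      ae_all_iff.2 fun k => coeFn_diffQuotL2 (u k)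
    filter_upwards [hD, hae', hall] with p h1 h2 h3
    refine tendsto_nhds_unique (h1.comp hks.tendsto_atTop) (h2.congr fun k => ?_)
    exact h3 _
  have hmem : MemLp (diffQuot s v) 2 (sqMeasure Ω) := (memLp_congr_ae hgv).2 (Lp.memLp g)
  let w : FracSobolev s Ω := ⟨v, hmem⟩
  have hw1 : w.toL2 = v := rfl
  have hw2 : diffQuotL2 w = g := Lp.ext ((coeFn_diffQuotL2 w).trans hgv)
  refine ⟨w, ?_⟩
  rw [tendsto_iff_norm_sub_tendsto_zero]
  have h1 := tendsto_iff_norm_sub_tendsto_zero.1 hv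
  have h2 := tendsto_iff_norm_sub_tendsto_zero.1 hg
  refine squeeze_zero (fun _ => norm_nonneg _) (fun k => ?_) (by simpa using h1.add h2)
  refine le_of_sq_le_sq ?_ (add_nonneg (norm_nonneg _) (norm_nonneg _))
  change ‖u k - w‖ ^ 2 ≤ (‖(u k).toL2 - v‖ + ‖diffQuotL2 (u k) - g‖) ^ 2
  rw [norm_sq_eq_add, map_sub, map_sub, hw1, hw2]
  nlinarith [norm_nonneg ((u k).toL2 - v), norm_nonneg (diffQuotL2 (u k) - g)]

end Space

/-- A finite net of the image may be centred at points of the image; their preimages form a net of S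
when closeness of images forces closeness in S. -/
theorem exists_finite_cover_of_totallyBounded_image {X Y : Type*} [PseudoMetricSpace X]
    [PseudoMetricSpace Y] {S : Set X} {f : X → Y} (hf : TotallyBounded (f '' S)) {δ δ' : ℝ}
    (hδ' : 0 < δ') (h : ∀ x ∈ S, ∀ y ∈ S, dist (f x) (f y) < δ' → dist x y < δ) :
    ∃ t : Set X, t.Finite ∧ S ⊆ ⋃ y ∈ t, Metric.ball y δ := by
  obtain ⟨t, hts, htf, hcov⟩ := Metric.finite_approx_of_totallyBounded hf δ' hδ'
  obtain ⟨t', ht'S, ht'f, rfl⟩ := exists_subset_image_finite_and.1 ⟨t, hts, htf, rfl⟩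
  refine ⟨t', ht'f, fun x hx => ?_⟩
  obtain ⟨y, hy, hxy⟩ := by simpa using hcov (mem_image_of_mem f hx)
  exact mem_biUnion hy (h x hx y (ht'S hy) hxy)

/-! ### Poincaré's inequality and the compact embedding. -/

section Space

variable {n : ℕ} {s : ℝ} {Ω : Set (EuclideanSpace ℝ (Fin n))}

theorem IsSmoothBoundedDomain.isFiniteMeasure (hΩ : IsSmoothBoundedDomain Ω) :
    IsFiniteMeasure (volume.restrict Ω) :=
  ⟨by rw [Measure.restrict_apply_univ]; exact hΩ.isBounded.measure_lt_top⟩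

/-- `∫_Ω |u(x) - u(y)|² / |x - y| ^ (n + 2s) dy` -/
def gagliardoDensity (u : FracSobolev s Ω) (x : EuclideanSpace ℝ (Fin n)) : ℝ :=
  ∫ y in Ω, diffQuot s u (x, y) ^ 2

theorem integrable_gagliardoDensity (u : FracSobolev s Ω) :
    Integrable (gagliardoDensity u) (volume.restrict Ω) :=
  u.memLp_diffQuot.integrable_sq.integral_prod_left

theorem integral_gagliardoDensity (u : FracSobolev s Ω) :
    ∫ x in Ω, gagliardoDensity u x = ‖diffQuotL2 u‖ ^ 2 := by
  rw [norm_diffQuotL2_sq, integral_prod _ u.memLp_diffQuot.integrable_sq]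
  rfl

theorem sq_sub_le_mul_diffQuot_sq (hs : 0 < s) (u : EuclideanSpace ℝ (Fin n) → ℝ)
    {x y : EuclideanSpace ℝ (Fin n)} {D : ℝ} (h : ‖x - y‖ ≤ D) :
    (u x - u y) ^ 2 ≤ D ^ ((n : ℝ) + 2 * s) * diffQuot s u (x, y) ^ 2 := by
  rcases eq_or_ne x y with rfl | hxy
  · simp [diffQuot]
  · have hpos : 0 < ‖x - y‖ := norm_pos_iff.2 (sub_ne_zero.2 hxy)
    rw [diffQuot_sq, sq_abs, mul_div_assoc', le_div_iff₀ (Real.rpow_pos_of_pos hpos _), mul_comm]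
    exact mul_le_mul_of_nonneg_right (Real.rpow_le_rpow hpos.le h (by positivity)) (sq_nonneg _)

/-- By Jensen, the square of the mean of u(x) - u(y) over A is at most the mean of the squares; |x -
y| ≤ D then lets the singular kernel in at the cost of D^(n+2s). Both Poincaré's inequality (A = Ω)
and the compact embedding (A = Ω ∩ ball) come from this. -/
theorem sq_sub_average_le (hs : 0 < s) {A : Set (EuclideanSpace ℝ (Fin n))}
    (hA : MeasurableSet A) (hAΩ : A ⊆ Ω) (hA0 : 0 < volume.real A) {D : ℝ} (hD : 0 ≤ D)
    (u : FracSobolev s Ω) :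
    ∀ᵐ x ∂(volume.restrict Ω), (∀ y ∈ A, ‖x - y‖ ≤ D) →
      (u x - ⨍ y in A, u y) ^ 2 ≤
        D ^ ((n : ℝ) + 2 * s) / volume.real A * gagliardoDensity u x := by
  have hA0' : volume A ≠ 0 := fun h => by simp [measureReal_def, h] at hA0
  have hAt : volume A ≠ ⊤ := fun h => by simp [measureReal_def, h] at hA0
  have : IsFiniteMeasure (volume.restrict A) := ⟨by simpa using hAt.lt_top⟩
  have hle : volume.restrict A ≤ volume.restrict Ω := Measure.restrict_mono_set _ hAΩ
  have huA : MemLp u 2 (volume.restrict A) := u.memLp.mono_measure hle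
  filter_upwards [u.memLp_diffQuot.integrable_sq.prod_right_ae] with x hx hxD
  have hd : MemLp (fun y => u x - u y) 2 (volume.restrict A) := (memLp_const (u x)).sub huA
  have hxA : IntegrableOn (fun y => diffQuot s u (x, y) ^ 2) A := hx.mono_measure hle
  have e1 : u x - ⨍ y in A, u y = ⨍ y in A, (u x - u y) := by
    rw [setAverage_eq, setAverage_eq,
      integral_sub (integrable_const _) (huA.integrable (by norm_num)), setIntegral_const,
      smul_eq_mul, smul_eq_mul, smul_eq_mul, mul_sub, inv_mul_cancel_left₀ hA0.ne']
  have e2 : (⨍ y in A, (u x - u y)) ^ 2 ≤ ⨍ y in A, (u x - u y) ^ 2 :=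
    (even_two.convexOn_pow (𝕜 := ℝ)).map_set_average_le (continuous_pow 2).continuousOn isClosed_univ
      hA0' hAt (by simp) (hd.integrable (by norm_num)) hd.integrable_sq
  have e3 : ∫ y in A, (u x - u y) ^ 2 ≤
      ∫ y in A, D ^ ((n : ℝ) + 2 * s) * diffQuot s u (x, y) ^ 2 :=
    setIntegral_mono_on hd.integrable_sq (hxA.const_mul _) hA
      fun y hy => sq_sub_le_mul_diffQuot_sq hs u (hxD y hy)
  have e4 : ∫ y in A, diffQuot s u (x, y) ^ 2 ≤ gagliardoDensity u x :=
    setIntegral_mono_set hx (Eventually.of_forall fun y => sq_nonneg _) hAΩ.eventuallyLE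
  rw [integral_const_mul] at e3
  rw [e1]
  refine e2.trans ?_
  rw [setAverage_eq, smul_eq_mul, inv_mul_le_iff₀ hA0]
  refine (e3.trans (mul_le_mul_of_nonneg_left e4 (by positivity))).trans (le_of_eq ?_)
  field_simp

theorem norm_toL2_sq_le_of_ae [IsFiniteMeasure (volume.restrict Ω)] {a b : ℝ}
    (u : FracSobolev s Ω)
    (h : ∀ᵐ x ∂(volume.restrict Ω), u x ^ 2 ≤ a * gagliardoDensity u x + b) :
    ‖u.toL2‖ ^ 2 ≤ a * ‖diffQuotL2 u‖ ^ 2 + b * volume.real Ω := by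
  have i1 := (integrable_gagliardoDensity u).const_mul a
  have i2 := integrable_const (μ := volume.restrict Ω) b
  rw [norm_toL2_sq, ← integral_gagliardoDensity]
  refine (integral_mono_ae u.memLp.integrable_sq (i1.add i2) h).trans (le_of_eq ?_)
  simp only [Pi.add_apply]
  rw [integral_add i1 i2, integral_const_mul, setIntegral_const, smul_eq_mul, mul_comm b]

/-- Poincaré's inequality for the Gagliardo seminorm. -/
theorem exists_norm_toL2_sq_le (hΩ : IsSmoothBoundedDomain Ω) (hs : 0 < s) :
    ∃ C : ℝ, 0 ≤ C ∧ ∀ u : FracSobolev s Ω,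
      ‖u.toL2‖ ^ 2 ≤ C * (‖diffQuotL2 u‖ ^ 2 + (∫ x in Ω, |u x|) ^ 2) := by
  have := hΩ.isFiniteMeasure
  rcases (measureReal_nonneg (μ := volume) (s := Ω)).eq_or_lt with h0 | h0
  · refine ⟨0, le_rfl, fun u => ?_⟩
    have hz : volume Ω = 0 := by
      rcases (ENNReal.toReal_eq_zero_iff _).1 h0.symm with h | h
      · exact h
      · exact absurd h hΩ.isBounded.measure_lt_top.ne
    rw [norm_toL2_sq, setIntegral_measure_zero _ hz, zero_mul]
  set V := volume.real Ω with hV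
  set a : ℝ := 2 * (Metric.diam Ω ^ ((n : ℝ) + 2 * s) / V) with ha
  have hd0 : 0 ≤ Metric.diam Ω := Metric.diam_nonneg
  have ha0 : 0 ≤ a := by positivity
  refine ⟨a + 2 / V, by positivity, fun u => ?_⟩
  have key : ‖u.toL2‖ ^ 2 ≤ a * ‖diffQuotL2 u‖ ^ 2 + 2 * (⨍ y in Ω, u y) ^ 2 * V := by
    refine norm_toL2_sq_le_of_ae u ?_
    filter_upwards [sq_sub_average_le hs hΩ.isOpen.measurableSet subset_rfl h0 hd0 u,
      ae_restrict_mem hΩ.isOpen.measurableSet] with x hx hxΩ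
    have h1 := hx fun y hy => by
      rw [← dist_eq_norm]; exact Metric.dist_le_diam_of_mem hΩ.isBounded hxΩ hy
    rw [ha, mul_assoc]
    -- The hint is u² ≤ 2(u - m)² + 2m² in disguise, m being the mean.
    nlinarith [sq_nonneg (u x - 2 * ⨍ y in Ω, u y)]
  have havg : (⨍ y in Ω, u y) ^ 2 * V ≤ (∫ x in Ω, |u x|) ^ 2 / V := by
    rw [setAverage_eq, smul_eq_mul, mul_pow, ← hV]
    have h2 : (∫ y in Ω, u y) ^ 2 ≤ (∫ x in Ω, |u x|) ^ 2 :=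
      sq_le_sq.2 ((abs_integral_le_integral_abs).trans (le_abs_self _))
    calc _ = (∫ y in Ω, u y) ^ 2 / V := by field_simp
      _ ≤ _ := by gcongr
  have h3 : 0 ≤ 2 / V * ‖diffQuotL2 u‖ ^ 2 := by positivity
  have h4 : 0 ≤ a * (∫ x in Ω, |u x|) ^ 2 := by positivity
  have h5 : 2 / V * (∫ x in Ω, |u x|) ^ 2 = 2 * ((∫ x in Ω, |u x|) ^ 2 / V) := by ring
  nlinarith

theorem exists_average_clm {A : Set (EuclideanSpace ℝ (Fin n))}
    (hA : MeasurableSet A) (hAΩ : A ⊆ Ω) (hAt : volume A ≠ ⊤) :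
    ∃ ℓ : Lp ℝ 2 (volume.restrict Ω) →L[ℝ] ℝ, ∀ f, ℓ f = ⨍ y in A, f y := by
  have hAt' : volume.restrict Ω A ≠ ⊤ :=
    ((Measure.restrict_apply_le Ω A).trans_lt hAt.lt_top).ne
  refine ⟨(volume.real A)⁻¹ • innerSL ℝ (indicatorConstLp 2 hA hAt' (1 : ℝ)), fun f => ?_⟩
  rw [setAverage_eq, smul_apply, innerSL_apply_apply,
    L2.inner_indicatorConstLp_one hA hAt' f, Measure.restrict_restrict hA,
    inter_eq_self_of_subset_left hAΩ]

/-- Up to a small multiple of the Gagliardo seminorm, the `L²` norm on `H^s(Ω)` is controlled by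
finitely many continuous linear functionals on `L²(Ω)`. -/
theorem exists_finset_norm_toL2_sq_le (hΩ : IsSmoothBoundedDomain Ω) (hs : 0 < s) {η : ℝ}
    (hη : 0 < η) : ∃ (t : Finset (EuclideanSpace ℝ (Fin n)))
      (ℓ : EuclideanSpace ℝ (Fin n) → Lp ℝ 2 (volume.restrict Ω) →L[ℝ] ℝ),
      ∀ u : FracSobolev s Ω, ‖u.toL2‖ ^ 2 ≤
        η * ‖diffQuotL2 u‖ ^ 2 + (2 * ∑ i ∈ t, ℓ i u.toL2 ^ 2) * volume.real Ω := by
  have := hΩ.isFiniteMeasure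
  -- η/2 compensates for the factor 2 in u² ≤ 2(u - m)² + 2m².
  have hr : ∀ x : EuclideanSpace ℝ (Fin n), ∃ r : ℝ, x ∈ closure Ω → 0 < r ∧
      0 < volume.real (Ω ∩ Metric.ball x r) ∧
      (2 * r) ^ ((n : ℝ) + 2 * s) ≤ η / 2 * volume.real (Ω ∩ Metric.ball x r) := by
    intro x
    by_cases hx : x ∈ closure Ω
    · obtain ⟨r, h⟩ := hΩ.exists_radius hx hs (half_pos hη)
      exact ⟨r, fun _ => h⟩
    · exact ⟨0, fun h => absurd h hx⟩
  choose r hr using hr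
  have hAm : ∀ x, MeasurableSet (Ω ∩ Metric.ball x (r x)) := fun x =>
    hΩ.isOpen.measurableSet.inter measurableSet_ball
  choose ℓ hℓ using fun x => exists_average_clm (hAm x) inter_subset_left
    ((measure_mono inter_subset_right).trans_lt (measure_ball_lt_top (μ := volume))).ne
  obtain ⟨t, ht, hcov⟩ := hΩ.isBounded.isCompact_closure.elim_nhds_subcover
    (fun x => Metric.ball x (r x)) fun x hx => Metric.ball_mem_nhds x (hr x hx).1
  refine ⟨t, ℓ, fun u => norm_toL2_sq_le_of_ae u ?_⟩
  have hall : ∀ i ∈ t, ∀ᵐ x ∂(volume.restrict Ω),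
      (∀ y ∈ Ω ∩ Metric.ball i (r i), ‖x - y‖ ≤ 2 * r i) →
      (u x - ⨍ y in Ω ∩ Metric.ball i (r i), u y) ^ 2 ≤ (2 * r i) ^ ((n : ℝ) + 2 * s) /
        volume.real (Ω ∩ Metric.ball i (r i)) * gagliardoDensity u x := fun i hi =>
    sq_sub_average_le hs (hAm i) inter_subset_left (hr i (ht i hi)).2.1
      (by linarith [(hr i (ht i hi)).1]) u
  filter_upwards [(Finset.eventually_all t).2 hall, ae_restrict_mem hΩ.isOpen.measurableSet]
    with x hx hxΩ
  obtain ⟨i, hi, hxi⟩ := mem_iUnion₂.1 (hcov (subset_closure hxΩ))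
  obtain ⟨-, hA0, hrA⟩ := hr i (ht i hi)
  have h1 := hx i hi fun y hy => by
    rw [← dist_eq_norm]
    have := dist_triangle_right x y i
    have h2 := Metric.mem_ball.1 hxi
    have h3 := Metric.mem_ball.1 hy.2
    linarith
  rw [← hℓ] at h1
  have hg0 : 0 ≤ gagliardoDensity u x := integral_nonneg fun y => sq_nonneg _
  have h2 : (2 * r i) ^ ((n : ℝ) + 2 * s) / volume.real (Ω ∩ Metric.ball i (r i)) *
      gagliardoDensity u x ≤ η / 2 * gagliardoDensity u x :=
    mul_le_mul_of_nonneg_right ((div_le_iff₀ hA0).2 hrA) hg0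
  have h3 : ℓ i u.toL2 ^ 2 ≤ ∑ i ∈ t, ℓ i u.toL2 ^ 2 :=
    Finset.single_le_sum (f := fun i => ℓ i u.toL2 ^ 2) (fun _ _ => sq_nonneg _) hi
  nlinarith [sq_nonneg (u x - 2 * ℓ i u.toL2)]

/-- The compact embedding of `H^s(Ω)` into `L²(Ω)`. -/
theorem totallyBounded_image_toL2 (hΩ : IsSmoothBoundedDomain Ω) (hs : 0 < s)
    {K : Set (FracSobolev s Ω)} {R : ℝ} (hK : ∀ u ∈ K, ‖u‖ ≤ R) :
    TotallyBounded (toL2CLM '' K) := by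
  refine Metric.totallyBounded_iff.2 fun δ hδ => ?_
  obtain ⟨t, ℓ, h⟩ := exists_finset_norm_toL2_sq_le (s := s) hΩ hs
    -- Differences of elements of K have norm at most 2R, so this η keeps the seminorm part below
    -- δ²/4; the summand 1 keeps the denominator positive.
    (η := δ ^ 2 / (4 * (4 * R ^ 2 + 1))) (by positivity)
  set c : ℝ := 2 * t.card * volume.real Ω with hc
  have hc0 : 0 ≤ c := by positivity
  set δ' : ℝ := δ / (2 * (c + 1)) with hδ'
  have hδ'0 : 0 < δ' := by positivity
  -- T has finite-dimensional target, so it sends bounded sets to totally bounded ones, and on K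
  -- closeness under T implies closeness in L².
  let T : Lp ℝ 2 (volume.restrict Ω) →L[ℝ] (t → ℝ) := ContinuousLinearMap.pi fun i => ℓ i
  have hbd : Bornology.IsBounded (toL2CLM '' K) := by
    refine isBounded_iff_forall_norm_le.2 ⟨R, ?_⟩
    rintro _ ⟨u, hu, rfl⟩
    exact (norm_toL2_le u).trans (hK u hu)
  refine exists_finite_cover_of_totallyBounded_image (f := T)
    ((T.lipschitz.isBounded_image hbd).isCompact_closure.totallyBounded.subset subset_closure) hδ'0 ?_
  rintro _ ⟨u, hu, rfl⟩ _ ⟨v, hv, rfl⟩ huv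
  rw [dist_eq_norm, ← map_sub] at huv ⊢
  rw [← map_sub] at huv
  set w := u - v with hw
  have hwR : ‖diffQuotL2 w‖ ≤ 2 * R :=
    (norm_diffQuotL2_le w).trans ((norm_sub_le u v).trans (by linarith [hK u hu, hK v hv]))
  have h1 : δ ^ 2 / (4 * (4 * R ^ 2 + 1)) * ‖diffQuotL2 w‖ ^ 2 ≤ δ ^ 2 / 4 := by
    have : ‖diffQuotL2 w‖ ^ 2 ≤ 4 * R ^ 2 + 1 := by nlinarith [norm_nonneg (diffQuotL2 w)]
    calc _ ≤ δ ^ 2 / (4 * (4 * R ^ 2 + 1)) * (4 * R ^ 2 + 1) := by gcongr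
      _ = δ ^ 2 / 4 := by field_simp
  have h2 : ∑ i ∈ t, ℓ i w.toL2 ^ 2 ≤ t.card * δ' ^ 2 := by
    rw [← nsmul_eq_mul]
    refine Finset.sum_le_card_nsmul _ _ _ fun i hi => ?_
    have h3 : |ℓ i w.toL2| ≤ ‖T (toL2CLM w)‖ := norm_le_pi_norm (T (toL2CLM w)) ⟨i, hi⟩
    exact sq_le_sq' (by linarith [neg_abs_le (ℓ i w.toL2)]) ((le_abs_self _).trans (h3.trans huv.le))
  have h3 : c * δ' ^ 2 ≤ δ ^ 2 / 4 := by
    rw [hδ', div_pow, mul_div_assoc', div_le_div_iff₀ (by positivity) (by norm_num)]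
    nlinarith [mul_nonneg (sq_nonneg δ) (sq_nonneg (c - 1)), mul_nonneg (sq_nonneg δ) hc0,
      sq_nonneg δ, mul_nonneg (sq_nonneg δ) (sq_nonneg c)]
  have h4 : (2 * ∑ i ∈ t, ℓ i w.toL2 ^ 2) * volume.real Ω ≤ c * δ' ^ 2 := by
    rw [hc]
    have : 0 ≤ volume.real Ω := measureReal_nonneg
    nlinarith [mul_le_mul_of_nonneg_right h2 this]
  have h5 := h w
  refine lt_of_pow_lt_pow_left₀ 2 hδ.le ?_
  rw [toL2CLM_apply]
  nlinarith

end Space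

/-! ### The energy: derivative, coercivity, and control of H^s distances. -/

section Space

variable {n : ℕ} {s : ℝ} {Ω : Set (EuclideanSpace ℝ (Fin n))} {W : ℝ → ℝ} {C : ℝ}

/-- The three ranges of s differ only in positive coefficients; at s = 1/2, ε ≠ 1 keeps log ε from
vanishing. -/
theorem exists_energy_eq {ε : ℝ} (hε : 0 < ε) (hε1 : s = 1 / 2 → ε ≠ 1) :
    ∃ a b : ℝ, 0 < a ∧ 0 < b ∧ energy (s := s) (Ω := Ω) ε W =
      fun u => a * ‖diffQuotCLM u‖ ^ 2 + b * ∫ x in Ω, W (toL2CLM u x) := by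
  unfold energy
  simp only [gagliardo_eq, diffQuotCLM_apply, toL2CLM_apply]
  split_ifs with h1 h2
  · exact ⟨1, 1 / ε ^ (2 * s), one_pos, by positivity, by simp⟩
  · have hlog : Real.log ε ≠ 0 := Real.log_ne_zero_of_pos_of_ne_one hε (hε1 h2)
    exact ⟨_, _, one_div_pos.2 (abs_pos.2 hlog), one_div_pos.2 (abs_pos.2 (mul_ne_zero hε.ne' hlog)),
      rfl⟩
  · exact ⟨_, _, by positivity, by positivity, rfl⟩

/-- The derivative at `u` of `a [u]_s² + b ∫_Ω W(u)`. -/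
def energyDeriv [IsFiniteMeasure (volume.restrict Ω)] (hW' : Continuous (deriv W))
    (hC : ∀ t, |deriv W t| ≤ C * (1 + |t|)) (a b : ℝ) (u : FracSobolev s Ω) :
    FracSobolev s Ω →L[ℝ] ℝ :=
  a • (2 • (innerSL ℝ (diffQuotCLM u)).comp diffQuotCLM) +
    b • (innerSL ℝ (superposition hW' hC (toL2CLM u))).comp toL2CLM

theorem energyDeriv_apply [IsFiniteMeasure (volume.restrict Ω)] (hW' : Continuous (deriv W))
    (hC : ∀ t, |deriv W t| ≤ C * (1 + |t|)) (a b : ℝ) (u v : FracSobolev s Ω) :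
    energyDeriv hW' hC a b u v = a * (2 * inner ℝ (diffQuotCLM u) (diffQuotCLM v)) +
      b * inner ℝ (superposition hW' hC (toL2CLM u)) (toL2CLM v) := by
  simp [energyDeriv]

theorem hasFDerivAt_energy [IsFiniteMeasure (volume.restrict Ω)] (hW : Differentiable ℝ W)
    (hW' : Continuous (deriv W)) (hC : ∀ t, |deriv W t| ≤ C * (1 + |t|)) (a b : ℝ)
    (u : FracSobolev s Ω) :
    HasFDerivAt (fun u => a * ‖diffQuotCLM u‖ ^ 2 + b * ∫ x in Ω, W (toL2CLM u x))
      (energyDeriv hW' hC a b u) u := by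
  have h1 := (diffQuotCLM (s := s) (Ω := Ω)).hasFDerivAt (x := u) |>.norm_sq
  have h2 := (hasFDerivAt_integral_comp hW hW' hC (toL2CLM u)).comp u
    (toL2CLM (s := s) (Ω := Ω)).hasFDerivAt
  exact (h1.const_mul a).add (h2.const_mul b)

theorem continuous_energyDeriv [IsFiniteMeasure (volume.restrict Ω)] (hW' : Continuous (deriv W))
    (hC : ∀ t, |deriv W t| ≤ C * (1 + |t|)) (a b : ℝ) :
    Continuous (energyDeriv (s := s) (Ω := Ω) hW' hC a b) := by
  have h1 : Continuous fun u : FracSobolev s Ω =>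
      (innerSL ℝ (diffQuotCLM u)).comp (diffQuotCLM (s := s) (Ω := Ω)) :=
    ((innerSL ℝ).continuous.comp diffQuotCLM.continuous).clm_comp continuous_const
  have h2 : Continuous fun u : FracSobolev s Ω =>
      (innerSL ℝ (superposition hW' hC (toL2CLM u))).comp (toL2CLM (s := s) (Ω := Ω)) :=
    ((innerSL ℝ).continuous.comp
      ((continuous_superposition hW' hC).comp toL2CLM.continuous)).clm_comp continuous_const
  exact ((h1.const_smul 2).const_smul a).add (h2.const_smul b)

/-- Coercivity: a bound on the energy bounds the norm of `H^s(Ω)`. -/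
theorem exists_norm_le_of_energy_le (hΩ : IsSmoothBoundedDomain Ω) (hs : 0 < s)
    (hW : Differentiable ℝ W) (hC : ∀ t, |deriv W t| ≤ C * (1 + |t|)) (hW0 : ∀ t, 0 ≤ W t)
    {α β : ℝ} (hα : 0 < α) (hαβ : ∀ t, α * |t| - β ≤ W t) {a b : ℝ} (ha : 0 < a) (hb : 0 < b)
    (M : ℝ) : ∃ R : ℝ, ∀ u : FracSobolev s Ω,
      a * ‖diffQuotCLM u‖ ^ 2 + b * ∫ x in Ω, W (toL2CLM u x) ≤ M → ‖u‖ ≤ R := by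
  have := hΩ.isFiniteMeasure
  obtain ⟨P, hP0, hP⟩ := exists_norm_toL2_sq_le (s := s) hΩ hs
  set V := volume.real Ω with hV
  -- Q bounds the L¹ norm, from α∫|u| ≤ ∫W(u) + β|Ω|. Linear growth of W suffices since Poincaré's
  -- inequality needs only this norm.
  set Q : ℝ := (M / b + β * V) / α with hQ
  refine ⟨√(P * (M / a + Q ^ 2) + M / a), fun u hu => ?_⟩
  have hWi : 0 ≤ ∫ x in Ω, W (toL2CLM u x) := integral_nonneg fun x => hW0 _
  have h1 : ‖diffQuotL2 u‖ ^ 2 ≤ M / a := by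
    rw [le_div_iff₀ ha, mul_comm]
    have := mul_nonneg hb.le hWi
    rw [diffQuotCLM_apply] at hu
    linarith
  have h2 : ∫ x in Ω, W (u x) ≤ M / b := by
    rw [le_div_iff₀ hb, mul_comm]
    have : 0 ≤ a * ‖diffQuotCLM u‖ ^ 2 := by positivity
    rw [toL2CLM_apply] at hu
    linarith
  have habs : Integrable (fun x => |u x|) (volume.restrict Ω) :=
    (u.memLp.integrable (by norm_num)).abs
  have h3 : α * ∫ x in Ω, |u x| ≤ M / b + β * V := by
    have i1 := habs.const_mul α
    have i2 := integrable_const (μ := volume.restrict Ω) β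
    have h := integral_mono (i1.sub i2) (integrable_comp_of_deriv_growth hW hC u.toL2)
      fun x => hαβ (u x)
    simp only [Pi.sub_apply] at h
    rw [integral_sub i1 i2, integral_const_mul, setIntegral_const, smul_eq_mul, mul_comm _ β] at h
    linarith
  have h4 : ∫ x in Ω, |u x| ≤ Q := by rw [hQ, le_div_iff₀ hα, mul_comm]; exact h3
  have h5 : (∫ x in Ω, |u x|) ^ 2 ≤ Q ^ 2 :=
    pow_le_pow_left₀ (integral_nonneg fun x => abs_nonneg _) h4 2
  refine Real.le_sqrt_of_sq_le ?_
  rw [norm_sq_eq_add]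
  have h6 := mul_le_mul_of_nonneg_left (add_le_add h1 h5) hP0
  linarith [hP u]

/-- On bounded sets, closeness in `L²(Ω)` and of the derivatives of the energy implies closeness
in `H^s(Ω)`. -/
theorem exists_dist_lt_of_dist_energyDeriv_lt [IsFiniteMeasure (volume.restrict Ω)]
    (hW' : Continuous (deriv W)) (hC : ∀ t, |deriv W t| ≤ C * (1 + |t|)) {a b : ℝ} (ha : 0 < a)
    (hb : 0 < b) {R δ : ℝ} (hδ : 0 < δ) :
    ∃ δ' : ℝ, 0 < δ' ∧ ∀ u v : FracSobolev s Ω, ‖u‖ ≤ R → ‖v‖ ≤ R →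
      dist (toL2CLM u) (toL2CLM v) < δ' →
      (∀ w, |energyDeriv hW' hC a b u w - energyDeriv hW' hC a b v w| ≤ δ' * ‖w‖) →
      dist u v < δ := by
  rcases lt_or_ge R 0 with hR | hR
  · exact ⟨1, one_pos, fun u v hu => absurd (hu.trans_lt hR) (norm_nonneg u).not_gt⟩
  have hC0 : 0 ≤ C := by simpa using (abs_nonneg _).trans (hC 0)
  set Q : ℝ := C * (‖Lp.const 2 (volume.restrict Ω) (1 : ℝ)‖ + R) with hQ
  have hQ0 : 0 ≤ Q := by positivity
  have hN : ∀ u : FracSobolev s Ω, ‖u‖ ≤ R → ‖superposition hW' hC (toL2CLM u)‖ ≤ Q := by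
    intro u hu
    refine (norm_superposition_le hW' hC _).trans (mul_le_mul_of_nonneg_left ?_ hC0)
    have : ‖toL2CLM u‖ ≤ R := (norm_toL2_le u).trans hu
    linarith
  set L : ℝ := 1 + (R + b * Q) / a with hL
  have hL0 : 0 < L := by positivity
  -- With w = u - v, the estimates below give ‖Dw‖² ≤ δ'(R + bQ)/a, and ‖w‖² < δ' in L² because δ' ≤
  -- 1; the sum is below δ'L ≤ δ².
  refine ⟨min 1 (δ ^ 2 / L), by positivity, fun u v hu hv h1 h2 => ?_⟩
  set δ' := min 1 (δ ^ 2 / L) with hδ'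
  have hδ'0 : 0 < δ' := by positivity
  rw [dist_eq_norm] at h1 ⊢
  rw [← map_sub] at h1
  set w := u - v with hw
  have hwR : ‖w‖ ≤ 2 * R := (norm_sub_le u v).trans (by linarith)
  -- Testing on w itself turns the quadratic part into the seminorm; the potential part pairs a
  -- bounded element of L² with w, which is small in L².
  have hid : energyDeriv hW' hC a b u w - energyDeriv hW' hC a b v w =
      2 * a * ‖diffQuotCLM w‖ ^ 2 + b * inner ℝ (superposition hW' hC (toL2CLM u) -
        superposition hW' hC (toL2CLM v)) (toL2CLM w) := by
    rw [energyDeriv_apply, energyDeriv_apply, inner_sub_left,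
      ← real_inner_self_eq_norm_sq]
    conv_rhs => rw [hw, map_sub diffQuotCLM u v, inner_sub_left]
    rw [← map_sub diffQuotCLM u v]
    ring
  have h3 : energyDeriv hW' hC a b u w - energyDeriv hW' hC a b v w ≤ δ' * (2 * R) :=
    (le_abs_self _).trans ((h2 w).trans (mul_le_mul_of_nonneg_left hwR hδ'0.le))
  have h4 : -(2 * Q * δ') ≤ inner ℝ (superposition hW' hC (toL2CLM u) -
      superposition hW' hC (toL2CLM v)) (toL2CLM w) := by
    refine neg_le_of_abs_le ((abs_real_inner_le_norm _ _).trans ?_)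
    exact mul_le_mul ((norm_sub_le _ _).trans (by linarith [hN u hu, hN v hv])) h1.le
      (norm_nonneg _) (by positivity)
  have h5 : a * ‖diffQuotCLM w‖ ^ 2 ≤ δ' * (R + b * Q) := by
    have := mul_le_mul_of_nonneg_left h4 hb.le
    linarith
  have h6 : ‖diffQuotCLM w‖ ^ 2 ≤ δ' * ((R + b * Q) / a) := by
    rw [mul_div_assoc', le_div_iff₀ ha, mul_comm]
    exact h5
  have h7 : ‖toL2CLM w‖ ^ 2 < δ' := by
    have h8 : δ' ≤ 1 := min_le_left _ _
    nlinarith [norm_nonneg (toL2CLM w)]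
  have h9 : δ' * L ≤ δ ^ 2 := (le_div_iff₀ hL0).1 (min_le_right _ _)
  refine lt_of_pow_lt_pow_left₀ 2 hδ.le ?_
  rw [norm_sq_eq_add]
  rw [toL2CLM_apply] at h7
  rw [diffQuotCLM_apply] at h6
  calc _ < δ' + δ' * ((R + b * Q) / a) := add_lt_add_of_lt_of_le h7 h6
    _ = δ' * L := by rw [hL]; ring
    _ ≤ δ ^ 2 := h9

end Space

end FracAllenCahn

end

/-! ### Regularity and the Palais–Smale condition. -/

theorem lemma3p7 {n : ℕ} (hn : 1 ≤ n) {Ω : Set (EuclideanSpace ℝ (Fin n))}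
    (hΩ : FracAllenCahn.IsSmoothBoundedDomain Ω)
    {W : ℝ → ℝ} (hW : FracAllenCahn.IsDoubleWell W) (hgrowth : FracAllenCahn.HasGrowth W)
    {s ε : ℝ} (hs : s ∈ Set.Ioo (0 : ℝ) 1) (hε : 0 < ε) (hε1 : s = 1 / 2 → ε ≠ 1) :
    (∀ u : FracAllenCahn.FracSobolev s Ω,
      MeasureTheory.IntegrableOn (fun x => W (u x)) Ω) ∧
    ContDiff ℝ 1 (FracAllenCahn.energy (s := s) (Ω := Ω) ε W) ∧
    FracAllenCahn.PalaisSmale (FracAllenCahn.energy (s := s) (Ω := Ω) ε W) := by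
  have := hΩ.isFiniteMeasure
  obtain ⟨C, hC⟩ := hgrowth.deriv_upper
  obtain ⟨α, β, hα, hαβ⟩ := hgrowth.lower
  have hWd : Differentiable ℝ W := hW.contDiff.differentiable (by norm_num)
  have hW' : Continuous (deriv W) := hW.contDiff.continuous_deriv (by norm_num)
  obtain ⟨a, b, ha, hb, hE⟩ := FracAllenCahn.exists_energy_eq (Ω := Ω) (W := W) hε hε1
  have hderiv := FracAllenCahn.hasFDerivAt_energy (s := s) (Ω := Ω) hWd hW' hC a b
  rw [← hE] at hderiv
  refine ⟨fun u => FracAllenCahn.integrable_comp_of_deriv_growth hWd hC u.toL2,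
    contDiff_one_iff_hasFDerivAt.2
      ⟨_, FracAllenCahn.continuous_energyDeriv hW' hC a b, hderiv⟩, ?_⟩
  rintro u ⟨M, hM⟩ hlim
  obtain ⟨R, hR⟩ := FracAllenCahn.exists_norm_le_of_energy_le (s := s) hΩ hs.1 hWd hC hW.nonneg
    hα hαβ ha hb M
  have hu : ∀ v ∈ range u, ‖v‖ ≤ R := by
    rintro _ ⟨i, rfl⟩
    exact hR _ ((congrFun hE (u i)).symm.le.trans ((le_abs_self _).trans (hM i)))
  have htb1 := (FracAllenCahn.totallyBounded_image_toL2 hΩ hs.1 hu).closure.isCompact_of_isClosed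
    isClosed_closure
  -- A convergent sequence together with its limit is compact, so the derivatives lie in a compact
  -- subset of the dual.
  have htb2 := hlim.isCompact_insert_range
  have htb : TotallyBounded (range u) := by
    refine Metric.totallyBounded_iff.2 fun δ hδ => ?_
    obtain ⟨δ', hδ', h⟩ := FracAllenCahn.exists_dist_lt_of_dist_energyDeriv_lt (s := s) (Ω := Ω)
      hW' hC ha hb (R := R) hδ
    -- The pair (u in L², F'(u)) ranges in a product of compact sets, and on the sequence its
    -- closeness controls the H^s distance.
    refine FracAllenCahn.exists_finite_cover_of_totallyBounded_image
      (f := fun v => (FracAllenCahn.toL2CLM v, fderiv ℝ (FracAllenCahn.energy ε W) v))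
      ((htb1.prod htb2).totallyBounded.subset ?_) hδ' ?_
    · rintro _ ⟨v, hv, rfl⟩
      exact ⟨subset_closure (mem_image_of_mem _ hv), mem_insert_of_mem _ (hv.imp fun i hi => congrArg _ hi)⟩
    · intro v hv w hw hvw
      rw [Prod.dist_eq, max_lt_iff] at hvw
      refine h v w (hu v hv) (hu w hw) hvw.1 fun z => ?_
      rw [← (hderiv v).fderiv, ← (hderiv w).fderiv]
      refine (ContinuousLinearMap.le_opNorm (fderiv ℝ (FracAllenCahn.energy ε W) v -
        fderiv ℝ (FracAllenCahn.energy ε W) w) z).trans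
        (mul_le_mul_of_nonneg_right ?_ (norm_nonneg z))
      rw [← dist_eq_norm]
      exact hvw.2.le
  exact htb.closure.isCompact_of_isClosed isClosed_closure
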